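/- Let $I\subset\mathbb{R}^N$ be bounded, let $H\in(0,1]^N$, and put $\rho(s,t)=\sum_{j=1}^N|s_j-t_j|^{H_j}$ and $B_\rho(t,r)=\{s\in\mathbb{R}^N:\rho(s,t)\le r\}$. Let $X=(X(t))_{t\in I}$ be a centered Gaussian random field with values in $\mathbb{R}^d$ (all finite-dimensional distributions are jointly Gaussian with mean zero), and let $\|\cdot\|$ be the Euclidean norm. Assume that (1) there is a constant $c>0$ such that $\sqrt{\mathbb{E}[\|X(s)-X(t)\|^2]}\le c\,\rho(s,t)$ for all $s,t\in I$; (2) there is a constant $\lambda>0$ such that $\mathbb{E}\bigl[\bigl(\sum_{j=1}^d e_jX_j(t)\bigr)^2\bigr]\ge\lambda$ for all $t\in I$ and all $e\in\mathbb{R}^d$ with $\|e\|=1$. Assume moreover, as is always possible under (1) after passing to a version of $X$, that for some constant $\tilde c>0$, almost surely, $$\limsup_{\epsilon\downarrow0}\ \sup_{s,t\in I,\ \rho(s,t)\le\epsilon}\frac{\|X(s)-X(t)\|}{\epsilon\sqrt{\log(\epsilon^{-1})}}\le\tilde c .$$ For $L\ge0$ let $\mathrm{Lip}_\rho(L)$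 be the set of functions $f:I\to\mathbb{R}^d$ with $\|f(s)-f(t)\|\le L\,\rho(s,t)$ for all $s,t\in I$. Then for each $L\ge0$ there is a constant $C>0$ such that for all $t\in I$, all $r>0$ and all $f\in\mathrm{Lip}_\rho(L)$, $$\mathbb{P}\Bigl(\inf_{s\in B_\rho(t,r)\cap I}\|X(s)-f(s)\|\le r\Bigr)\le C\,r^d .$$ -/

import Mathlib

open MeasureTheory ProbabilityTheory Filter Topology
open scoped ENNReal

namespace AnisotropicField

/-- The anisotropic metric `ρ(s,t) = ∑ j, |s j - t j| ^ H j` on `ℝ^N`. -/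
noncomputable def rho {N : ℕ} (H : Fin N → ℝ) (s t : Fin N → ℝ) : ℝ :=
  ∑ j, |s j - t j| ^ H j

/-- The closed `ρ`-ball of radius `r` around `t`. -/
def closedBallRho {N : ℕ} (H : Fin N → ℝ) (t : Fin N → ℝ) (r : ℝ) : Set (Fin N → ℝ) :=
  {s | rho H s t ≤ r}

/-- The `L`-Lipschitz functions `I → ℝ^d` with respect to `ρ`. -/
def LipRho {N d : ℕ} (H : Fin N → ℝ) (I : Set (Fin N → ℝ)) (L : ℝ) :
    Set (I → EuclideanSpace ℝ (Fin d)) :=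
  {f | ∀ s t : I, ‖f s - f t‖ ≤ L * rho H s t}

/-- A centered Gaussian random field on `I ⊆ ℝ^N` with values in `ℝ^d`: all finite-dimensional
distributions are (jointly) Gaussian, and all means vanish. -/
structure IsCenteredGaussianField {N d : ℕ} {Ω : Type*} [MeasurableSpace Ω] (μ : Measure Ω)
    (I : Set (Fin N → ℝ)) (X : I → Ω → EuclideanSpace ℝ (Fin d)) : Prop where
  gaussian : IsGaussianProcess X μ
  centered : ∀ t, ∫ ω, X t ω ∂μ = 0

/-- The canonical metric of `X` is dominated by a multiple of `ρ`. -/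
def CanonicalMetricBound {N d : ℕ} {Ω : Type*} [MeasurableSpace Ω] (μ : Measure Ω)
    (H : Fin N → ℝ) (I : Set (Fin N → ℝ)) (X : I → Ω → EuclideanSpace ℝ (Fin d)) : Prop :=
  ∃ c : ℝ, 0 < c ∧ ∀ s t : I, √(∫ ω, ‖X s ω - X t ω‖ ^ 2 ∂μ) ≤ c * rho H s t

/-- The eigenvalues of the covariance matrices of `X` are uniformly bounded from below. -/
def CovarianceLowerBound {N d : ℕ} {Ω : Type*} [MeasurableSpace Ω] (μ : Measure Ω)
    (I : Set (Fin N → ℝ)) (X : I → Ω → EuclideanSpace ℝ (Fin d)) : Prop :=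
  ∃ l : ℝ, 0 < l ∧ ∀ t : I, ∀ e : EuclideanSpace ℝ (Fin d), ‖e‖ = 1 →
    l ≤ ∫ ω, (∑ j, e j * X t ω j) ^ 2 ∂μ

/-- `X` is a version with the uniform modulus of continuity `ε √(log (1 / ε))`: for a
deterministic constant `c'`, almost surely
`limsup_{ε ↓ 0} sup_{s, t ∈ I, ρ(s,t) ≤ ε} ‖X(s) - X(t)‖ / (ε √(log (1 / ε))) ≤ c'`.
The supremum and the limsup are taken in `[0, ∞]`. -/
def HasUniformModulus {N d : ℕ} {Ω : Type*} [MeasurableSpace Ω] (μ : Measure Ω)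
    (H : Fin N → ℝ) (I : Set (Fin N → ℝ)) (X : I → Ω → EuclideanSpace ℝ (Fin d)) : Prop :=
  ∃ c' : ℝ, 0 < c' ∧ ∀ᵐ ω ∂μ,
    limsup (fun ε : ℝ => ⨆ (s : I) (t : I) (_ : rho H s t ≤ ε),
      ENNReal.ofReal (‖X s ω - X t ω‖ / (ε * √(Real.log ε⁻¹)))) (𝓝[>] (0 : ℝ))
      ≤ ENNReal.ofReal c'

end AnisotropicField

/-!
The value `X t` has a nondegenerate Gaussian law, so it lies within `O(r)` of a fixed point with
probability `O(r ^ d)`. The point is to pass from `X t` to the infimum over a ball, and to have a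
bound which is uniform in the function `f`, whose values may be arbitrarily large.

Whiten `X t`: there are vectors `y i` such that the `G i = ⟪y i, X t⟫` are independent standard
normal variables, with norms bounded in terms of the covariance bound (`exists_whitening`,
`map_whitening_eq`). Regress the field on `G`, `X s = Z s + ∑ i, G i • v i s`, where
`v i s = E[G i X s]`. The residual process `Z` is independent of `G` (`indepFun_residual`), and `v i`
is Lipschitz for `ρ` by the Cauchy-Schwarz inequality. If `‖X s - f s‖ ≤ 2 r` for some `s` in the
ball of radius `r` around `t`, then `G` is within `O(r + sup ‖Z s - Z t‖ + r ∑ |G i|)` of the fixed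
vector with coordinates `⟪y i, f t⟫`.

Conditionally on `Z`, this is an event for a standard Gaussian vector alone, and
`exists_pi_gaussianReal_le` bounds its probability by a multiple of `(r + sup ‖Z s - Z t‖) ^ d`,
uniformly in the centre: the term `r ∑ |G i|` is absorbed by the Gaussian tails. It remains to see
that `sup ‖Z s - Z t‖` has a moment of large order `p` bounded by `C r ^ p`. Since all moments of
Gaussian increments are comparable and the covering numbers of `ρ`-balls are polynomial uniformly in
the radius (`exists_net`), chaining with a large `p` gives this (`norm_sub_le_chainSum`,
`lintegral_chainSum_le`), with no need for logarithmic entropy bounds. The modulus of continuity is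
used only to know that almost every path is continuous, so that nets control the supremum.
-/

namespace AnisotropicField

/-! ### The anisotropic metric and its covering numbers -/

section Metric

variable {N : ℕ} {H : Fin N → ℝ}

lemma rho_nonneg (s t : Fin N → ℝ) : 0 ≤ rho H s t :=
  Finset.sum_nonneg fun _ _ ↦ Real.rpow_nonneg (abs_nonneg _) _

lemma rho_comm (s t : Fin N → ℝ) : rho H s t = rho H t s := by
  simp only [rho, abs_sub_comm]

lemma rho_self (hH : ∀ j, 0 < H j) (s : Fin N → ℝ) : rho H s s = 0 := by
  simp only [rho, sub_self, abs_zero]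
  exact Finset.sum_eq_zero fun j _ ↦ Real.zero_rpow (hH j).ne'

lemma rho_triangle (hH : ∀ j, 0 < H j ∧ H j ≤ 1) (s t u : Fin N → ℝ) :
    rho H s u ≤ rho H s t + rho H t u := by
  rw [rho, rho, rho, ← Finset.sum_add_distrib]
  refine Finset.sum_le_sum fun j _ ↦ ?_
  calc |s j - u j| ^ H j ≤ (|s j - t j| + |t j - u j|) ^ H j :=
        Real.rpow_le_rpow (abs_nonneg _) (abs_sub_le _ _ _) (hH j).1.le
    _ ≤ _ := Real.rpow_add_le_add_rpow (abs_nonneg _) (abs_nonneg _) (hH j).1.le (hH j).2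

lemma rho_le_of_forall_le (hH : ∀ j, 0 < H j) {s t : Fin N → ℝ} {η : ℝ} (hη : 0 ≤ η)
    (h : ∀ j, |s j - t j| ≤ (η / (N + 1)) ^ (H j)⁻¹) : rho H s t ≤ η := by
  have hN : (0 : ℝ) < N + 1 := by positivity
  calc rho H s t ≤ ∑ _j : Fin N, η / (N + 1) := by
        refine Finset.sum_le_sum fun j _ ↦ ?_
        calc |s j - t j| ^ H j ≤ ((η / (N + 1)) ^ (H j)⁻¹) ^ H j :=
              Real.rpow_le_rpow (abs_nonneg _) (h j) (hH j).le
          _ = η / (N + 1) := Real.rpow_inv_rpow (by positivity) (hH j).ne'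
    _ = N * (η / (N + 1)) := by simp
    _ ≤ η := by
        rw [mul_div_assoc', div_le_iff₀ hN]
        nlinarith

lemma abs_sub_le_of_rho_le (hH : ∀ j, 0 < H j) {s t : Fin N → ℝ} {r : ℝ}
    (h : rho H s t ≤ r) (j : Fin N) : |s j - t j| ≤ r ^ (H j)⁻¹ := by
  have h1 : |s j - t j| ^ H j ≤ r :=
    (Finset.single_le_sum (f := fun j ↦ |s j - t j| ^ H j)
      (fun _ _ ↦ Real.rpow_nonneg (abs_nonneg _) _) (Finset.mem_univ j)).trans h
  calc |s j - t j| = (|s j - t j| ^ H j) ^ (H j)⁻¹ :=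
        (Real.rpow_rpow_inv (abs_nonneg _) (hH j).ne').symm
    _ ≤ r ^ (H j)⁻¹ := Real.rpow_le_rpow (Real.rpow_nonneg (abs_nonneg _) _) h1
        (inv_nonneg.2 (hH j).le)

/-- Polynomial covering numbers, scaled to the radius: every subset of a `ρ`-ball of radius `r`
contains, for each `n`, an `r / 4 ^ n`-net with at most `A * Q ^ n` points, where `A` and `Q` depend
only on `H`. The net picks one point in each cell of an anisotropic grid. -/
lemma exists_net (hH : ∀ j, 0 < H j) : ∃ A Q : ℕ, 1 ≤ A ∧ 1 ≤ Q ∧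
    ∀ (I : Set (Fin N → ℝ)) (S : Set I) (t : Fin N → ℝ) (r : ℝ), 0 < r →
      (∀ s ∈ S, rho H s t ≤ r) → ∀ n : ℕ, ∃ F : Finset I, F.card ≤ A * Q ^ n ∧
        ∀ s ∈ S, ∃ u ∈ F, rho H u s ≤ r / 4 ^ n := by
  obtain ⟨m, hm⟩ : ∃ m : ℕ, ∀ j, (H j)⁻¹ ≤ m := by
    obtain ⟨m, hm⟩ := exists_nat_ge (∑ j, (H j)⁻¹)
    exact ⟨m, fun j ↦ (Finset.single_le_sum (f := fun j ↦ (H j)⁻¹)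
      (fun i _ ↦ (inv_pos.2 (hH i)).le) (Finset.mem_univ j)).trans hm⟩
  refine ⟨(3 * (N + 1) ^ m) ^ N, (4 ^ m) ^ N, Nat.one_le_iff_ne_zero.2 (by positivity),
    Nat.one_le_iff_ne_zero.2 (by positivity), fun I S t r hr hS n ↦ ?_⟩
  set M : ℕ := (4 ^ n * (N + 1)) ^ m with hM
  set δ : Fin N → ℝ := fun j ↦ (r / 4 ^ n / (N + 1)) ^ (H j)⁻¹ with hδ
  have hδ0 : ∀ j, 0 < δ j := fun j ↦ by positivity
  let κ : I → Fin N → ℤ := fun s j ↦ ⌊((s : Fin N → ℝ) j - t j) / δ j⌋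
  let B : Finset (Fin N → ℤ) := Fintype.piFinset fun _ ↦ Finset.Icc (-(M : ℤ)) M
  have hB : B.card ≤ (3 * (N + 1) ^ m) ^ N * ((4 ^ m) ^ N) ^ n := by
    have h1 : B.card = (2 * M + 1) ^ N := by
      simp only [B, Fintype.card_piFinset, Int.card_Icc, Finset.prod_const, Finset.card_univ,
        Fintype.card_fin]
      congr 1
      omega
    have hM1 : 1 ≤ M := Nat.one_le_iff_ne_zero.2 (by positivity)
    calc B.card = (2 * M + 1) ^ N := h1
      _ ≤ (3 * M) ^ N := Nat.pow_le_pow_left (by omega) _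
      _ = _ := by
        simp only [hM, mul_pow, ← pow_mul]
        rw [show n * m * N = m * N * n by ring]
        ring
  have hratio : ∀ s ∈ S, ∀ j, |((s : Fin N → ℝ) j - t j) / δ j| ≤ M := by
    intro s hs j
    rw [abs_div, abs_of_pos (hδ0 j), div_le_iff₀ (hδ0 j)]
    refine (abs_sub_le_of_rho_le hH (hS s hs) j).trans ?_
    have hx : (1 : ℝ) ≤ 4 ^ n * (N + 1) :=
      one_le_mul_of_one_le_of_one_le (one_le_pow₀ (by norm_num)) (by simp)
    have h1 : (r : ℝ) = (4 ^ n * (N + 1)) * (r / 4 ^ n / (N + 1)) := by field_simp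
    calc r ^ (H j)⁻¹ = (4 ^ n * (N + 1) : ℝ) ^ (H j)⁻¹ * δ j := by
          rw [hδ, ← Real.mul_rpow (by positivity) (by positivity), ← h1]
      _ ≤ M * δ j := by
          refine mul_le_mul_of_nonneg_right ?_ (hδ0 j).le
          calc (4 ^ n * (N + 1) : ℝ) ^ (H j)⁻¹ ≤ (4 ^ n * (N + 1) : ℝ) ^ (m : ℝ) :=
                Real.rpow_le_rpow_of_exponent_le hx (hm j)
            _ = M := by rw [Real.rpow_natCast, hM]; push_cast; ring
  have hκ : κ '' S ⊆ B := by
    rintro _ ⟨s, hs, rfl⟩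
    simp only [B, Fintype.coe_piFinset, Set.mem_pi, Finset.coe_Icc, Set.mem_Icc]
    intro j _
    have := abs_le.1 (hratio s hs j)
    refine ⟨Int.le_floor.2 (by push_cast; exact this.1), ?_⟩
    have h2 : ((κ s j : ℤ) : ℝ) ≤ M := (Int.floor_le _).trans this.2
    exact_mod_cast h2
  obtain ⟨S', hS', hbij⟩ := Set.exists_subset_bijOn S κ
  have hfinim : (κ '' S).Finite := B.finite_toSet.subset hκ
  have hfin : S'.Finite := Set.Finite.of_injOn hbij.mapsTo hbij.injOn hfinim
  refine ⟨hfin.toFinset, ?_, fun s hs ↦ ?_⟩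
  · refine le_trans ?_ hB
    rw [← Set.ncard_eq_toFinset_card S' hfin, ← hbij.injOn.ncard_image,
      ← Set.ncard_coe_finset B]
    exact Set.ncard_le_ncard (hbij.image_eq ▸ hκ) B.finite_toSet
  · obtain ⟨u, hu, hus⟩ := hbij.surjOn ⟨s, hs, rfl⟩
    refine ⟨u, by simpa using hu, rho_le_of_forall_le hH (by positivity) fun j ↦ ?_⟩
    have h1 := Int.abs_sub_lt_one_of_floor_eq_floor (congrFun hus j)
    rw [← sub_div, abs_div, abs_of_pos (hδ0 j), div_lt_one (hδ0 j)] at h1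
    simpa using h1.le

end Metric

/-! ### Chaining along nets of polynomial size -/

section Chaining

variable {T E : Type*} [NormedAddCommGroup E]

open Classical in
/-- The links of a chain at level `n`: the pairs of points from the nets of levels `n` and `n + 1`
which are close enough to be consecutive approximations of one point. -/
noncomputable def chainLinks (D : T → T → ℝ) (F : ℕ → Finset T) (r : ℝ) (n : ℕ) :
    Finset (T × T) :=
  (F n ×ˢ F (n + 1)).filter fun q ↦ D q.1 q.2 ≤ 2 * r / 4 ^ n

/-- The chaining functional `∑ n, ∑ (u, v), (2 ^ n * ‖z u - z v‖) ^ p`, where `(u, v)` runs over the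
links of level `n`. It has values in `[0, ∞]`, so that no summability is presupposed. -/
noncomputable def chainSum (D : T → T → ℝ) (F : ℕ → Finset T) (r : ℝ) (p : ℕ) (z : T → E) : ℝ≥0∞ :=
  ∑' n : ℕ, ∑ q ∈ chainLinks D F r n, ENNReal.ofReal (2 ^ n * ‖z q.1 - z q.2‖) ^ p

lemma measurable_chainSum [MeasurableSpace E] [BorelSpace E] [SecondCountableTopology E]
    (D : T → T → ℝ) (F : ℕ → Finset T) (r : ℝ) (p : ℕ) :
    Measurable (chainSum (E := E) D F r p) := by
  refine Measurable.tsum fun n ↦ Finset.measurable_sum _ fun q _ ↦ ?_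
  refine (ENNReal.measurable_ofReal.comp ?_).pow_const p
  exact (((measurable_pi_apply q.1).sub (measurable_pi_apply q.2)).norm).const_mul _

lemma aemeasurable_chainSum {Ω : Type*} [MeasurableSpace Ω] {μ : Measure Ω}
    [MeasurableSpace E] [BorelSpace E] [SecondCountableTopology E]
    (D : T → T → ℝ) (F : ℕ → Finset T) (r : ℝ) (p : ℕ) {Z : T → Ω → E}
    (hZ : ∀ s, AEMeasurable (Z s) μ) : AEMeasurable (fun ω ↦ chainSum D F r p (Z · ω)) μ :=
  AEMeasurable.tsum fun _ ↦ Finset.aemeasurable_fun_sum _ fun q _ ↦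
    ((((hZ q.1).sub (hZ q.2)).norm.const_mul _).ennreal_ofReal).pow_const p

/-- The chaining functional controls the oscillation of every continuous path. -/
lemma norm_sub_le_chainSum {D : T → T → ℝ} (hDc : ∀ u v, D u v = D v u)
    (hDt : ∀ u v w, D u w ≤ D u v + D v w) {F : ℕ → Finset T} {r : ℝ} (hr : 0 < r) {t : T}
    (hF0 : F 0 = {t}) {p : ℕ} (hp : p ≠ 0) {S : Set T}
    (hF : ∀ s ∈ S, ∀ n, ∃ u ∈ F n, D u s ≤ r / 4 ^ n) {z : T → E}
    (hz : ∀ s ∈ S, ∀ ε > 0, ∃ δ > 0, ∀ u, D u s < δ → ‖z u - z s‖ < ε)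
    (hW : chainSum D F r p z ≠ ∞) {s : T} (hs : s ∈ S) :
    ‖z s - z t‖ ≤ 2 * (chainSum D F r p z).toReal ^ (p : ℝ)⁻¹ := by
  choose u huF hu using hF s hs
  set w := (chainSum D F r p z).toReal ^ (p : ℝ)⁻¹ with hw
  have hlink : ∀ n, (u n, u (n + 1)) ∈ chainLinks D F r n := by
    intro n
    simp only [chainLinks, Finset.mem_filter, Finset.mem_product]
    refine ⟨⟨huF n, huF (n + 1)⟩, (hDt _ s _).trans ?_⟩
    have h1 := hu (n + 1)
    rw [hDc] at h1
    have h2 : r / 4 ^ (n + 1) ≤ r / 4 ^ n :=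
      div_le_div_of_nonneg_left hr.le (by positivity)
        (pow_le_pow_right₀ (by norm_num) n.le_succ)
    have h3 := hu n
    rw [mul_div_assoc]
    linarith
  have hstep : ∀ n, ‖z (u n) - z (u (n + 1))‖ ≤ w / 2 ^ n := by
    intro n
    have h1 : ENNReal.ofReal (2 ^ n * ‖z (u n) - z (u (n + 1))‖) ^ p ≤ chainSum D F r p z :=
      le_trans (Finset.single_le_sum
        (f := fun q : T × T ↦ ENNReal.ofReal (2 ^ n * ‖z q.1 - z q.2‖) ^ p)
        (fun _ _ ↦ zero_le) (hlink n)) (ENNReal.le_tsum n)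
    have h2 : (2 ^ n * ‖z (u n) - z (u (n + 1))‖) ^ p ≤ (chainSum D F r p z).toReal := by
      rw [← ENNReal.ofReal_pow (by positivity)] at h1
      exact (ENNReal.ofReal_le_iff_le_toReal hW).1 h1
    rw [le_div_iff₀ (by positivity), mul_comm]
    calc 2 ^ n * ‖z (u n) - z (u (n + 1))‖
        = ((2 ^ n * ‖z (u n) - z (u (n + 1))‖) ^ p) ^ (p : ℝ)⁻¹ :=
          (Real.pow_rpow_inv_natCast (by positivity) hp).symm
      _ ≤ w := Real.rpow_le_rpow (by positivity) h2 (by positivity)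
  have hw0 : 0 ≤ w := Real.rpow_nonneg ENNReal.toReal_nonneg _
  have hu0 : u 0 = t := by simpa [hF0] using huF 0
  have hsum : ∀ n, ‖z (u n) - z t‖ ≤ 2 * w - 2 * w / 2 ^ n := by
    intro n
    induction n with
    | zero => simp [hu0]
    | succ n ih =>
      have h1 := norm_sub_le_norm_sub_add_norm_sub (z (u (n + 1))) (z (u n)) (z t)
      have h2 := hstep n
      rw [norm_sub_rev] at h2
      have h3 : 2 * w / 2 ^ (n + 1) = w / 2 ^ n := by
        rw [pow_succ]
        field_simp
      have h4 : 2 * w / 2 ^ n = 2 * (w / 2 ^ n) := mul_div_assoc _ _ _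
      rw [h3]
      linarith
  refine le_of_forall_pos_lt_add fun ε hε ↦ ?_
  obtain ⟨δ, hδ, hδz⟩ := hz s hs ε hε
  obtain ⟨n, hn⟩ : ∃ n : ℕ, r / 4 ^ n < δ := by
    obtain ⟨n, hn⟩ := pow_unbounded_of_one_lt (r / δ) (by norm_num : (1 : ℝ) < 4)
    exact ⟨n, by rw [div_lt_iff₀ (by positivity)]; rwa [div_lt_iff₀ hδ, mul_comm] at hn⟩
  have h1 := hδz (u n) ((hu n).trans_lt hn)
  have h2 := norm_sub_le_norm_sub_add_norm_sub (z s) (z (u n)) (z t)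
  have h3 : 0 ≤ 2 * w / 2 ^ n := by positivity
  rw [norm_sub_rev] at h1
  linarith [hsum n]

/-- If the `p`-th moments of the increments are dominated by `(K * D) ^ p`, then the chaining
functional has expectation `O(r ^ p)`, provided `p` beats the growth rate `Q` of the nets. -/
lemma lintegral_chainSum_le {Ω : Type*} [MeasurableSpace Ω] {μ : Measure Ω}
    [MeasurableSpace E] [BorelSpace E] [SecondCountableTopology E]
    {D : T → T → ℝ} {F : ℕ → Finset T} {r : ℝ} (hr : 0 < r) {p A Q : ℕ} (hpQ : 2 * Q ^ 2 ≤ 2 ^ p)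
    (hF : ∀ n, (F n).card ≤ A * Q ^ n) {Z : T → Ω → E} (hZ : ∀ s, AEMeasurable (Z s) μ)
    {K : ℝ} (hK : 0 ≤ K)
    (hm : ∀ u v, ∫⁻ ω, ENNReal.ofReal ‖Z u ω - Z v ω‖ ^ p ∂μ ≤ ENNReal.ofReal (K * D u v) ^ p) :
    ∫⁻ ω, chainSum D F r p (fun s ↦ Z s ω) ∂μ
      ≤ ENNReal.ofReal (2 * (A ^ 2 * Q) * (2 * K) ^ p * r ^ p) := by
  have hmeas : ∀ n (q : T × T), AEMeasurable
      (fun ω ↦ ENNReal.ofReal (2 ^ n * ‖Z q.1 ω - Z q.2 ω‖) ^ p) μ := fun n q ↦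
    ((((hZ q.1).sub (hZ q.2)).norm.const_mul _).ennreal_ofReal).pow_const p
  have hterm : ∀ n, ∀ q ∈ chainLinks D F r n,
      ∫⁻ ω, ENNReal.ofReal (2 ^ n * ‖Z q.1 ω - Z q.2 ω‖) ^ p ∂μ
        ≤ ENNReal.ofReal ((2 * K * r) ^ p * (1 / 2 ^ p) ^ n) := by
    intro n q hq
    have hq2 : D q.1 q.2 ≤ 2 * r / 4 ^ n := by
      classical
      exact (Finset.mem_filter.1 hq).2
    calc ∫⁻ ω, ENNReal.ofReal (2 ^ n * ‖Z q.1 ω - Z q.2 ω‖) ^ p ∂μ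
        = ∫⁻ ω, ENNReal.ofReal (2 ^ n) ^ p * ENNReal.ofReal ‖Z q.1 ω - Z q.2 ω‖ ^ p ∂μ := by
          refine lintegral_congr fun ω ↦ ?_
          rw [ENNReal.ofReal_mul (by positivity), mul_pow]
      _ = ENNReal.ofReal (2 ^ n) ^ p * ∫⁻ ω, ENNReal.ofReal ‖Z q.1 ω - Z q.2 ω‖ ^ p ∂μ :=
          lintegral_const_mul' _ _ (ENNReal.pow_ne_top ENNReal.ofReal_ne_top)
      _ ≤ ENNReal.ofReal (2 ^ n) ^ p * ENNReal.ofReal (K * (2 * r / 4 ^ n)) ^ p := by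
          gcongr
          refine (hm _ _).trans ?_
          gcongr
      _ = ENNReal.ofReal ((2 * K * r) ^ p * (1 / 2 ^ p) ^ n) := by
          rw [← mul_pow, ← ENNReal.ofReal_mul (by positivity), ← ENNReal.ofReal_pow (by positivity)]
          congr 1
          have h4 : (4 : ℝ) ^ n = 2 ^ n * 2 ^ n := by rw [← mul_pow]; norm_num
          have h5 : ((1 : ℝ) / 2 ^ p) ^ n = (1 / 2 ^ n) ^ p := by
            rw [one_div_pow, one_div_pow, ← pow_mul, ← pow_mul, mul_comm]
          rw [h5, ← mul_pow, h4]
          congr 1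
          field_simp
  have hcard : ∀ n, ((chainLinks D F r n).card : ℝ) ≤ A ^ 2 * Q * ((Q : ℝ) ^ 2) ^ n := by
    intro n
    classical
    have h1 : (chainLinks D F r n).card ≤ (A * Q ^ n) * (A * Q ^ (n + 1)) :=
      (Finset.card_filter_le _ _).trans (by
        rw [Finset.card_product]
        exact Nat.mul_le_mul (hF n) (hF (n + 1)))
    calc ((chainLinks D F r n).card : ℝ) ≤ ((A * Q ^ n) * (A * Q ^ (n + 1)) : ℕ) := by
          exact_mod_cast h1
      _ = _ := by push_cast; ring
  have hhalf : (Q : ℝ) ^ 2 * (1 / 2 ^ p) ≤ 1 / 2 := by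
    have : (2 * Q ^ 2 : ℝ) ≤ 2 ^ p := by exact_mod_cast hpQ
    rw [mul_one_div, div_le_iff₀ (by positivity)]
    linarith
  have hlevel : ∀ n, ∫⁻ ω, ∑ q ∈ chainLinks D F r n,
      ENNReal.ofReal (2 ^ n * ‖Z q.1 ω - Z q.2 ω‖) ^ p ∂μ
        ≤ ENNReal.ofReal (A ^ 2 * Q * (2 * K * r) ^ p * (1 / 2) ^ n) := by
    intro n
    rw [lintegral_finsetSum' _ fun q _ ↦ hmeas n q]
    refine (Finset.sum_le_card_nsmul _ _ _ (hterm n)).trans ?_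
    rw [nsmul_eq_mul, ← ENNReal.ofReal_natCast, ← ENNReal.ofReal_mul (by positivity)]
    refine ENNReal.ofReal_le_ofReal ?_
    calc ((chainLinks D F r n).card : ℝ) * ((2 * K * r) ^ p * (1 / 2 ^ p) ^ n)
        ≤ (A ^ 2 * Q * ((Q : ℝ) ^ 2) ^ n) * ((2 * K * r) ^ p * (1 / 2 ^ p) ^ n) :=
          mul_le_mul_of_nonneg_right (hcard n) (by positivity)
      _ = A ^ 2 * Q * (2 * K * r) ^ p * ((Q : ℝ) ^ 2 * (1 / 2 ^ p)) ^ n := by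
          rw [mul_pow ((Q : ℝ) ^ 2)]; ring
      _ ≤ _ := by gcongr
  have hgeom : HasSum (fun n : ℕ ↦ (A ^ 2 * Q * (2 * K * r) ^ p * (1 / 2) ^ n : ℝ))
      (A ^ 2 * Q * (2 * K * r) ^ p * 2) := hasSum_geometric_two.mul_left _
  calc ∫⁻ ω, chainSum D F r p (fun s ↦ Z s ω) ∂μ
      = ∑' n, ∫⁻ ω, ∑ q ∈ chainLinks D F r n,
          ENNReal.ofReal (2 ^ n * ‖Z q.1 ω - Z q.2 ω‖) ^ p ∂μ :=
        lintegral_tsum fun n ↦ Finset.aemeasurable_fun_sum _ fun q _ ↦ hmeas n q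
    _ ≤ ∑' n, ENNReal.ofReal (A ^ 2 * Q * (2 * K * r) ^ p * (1 / 2) ^ n) :=
        ENNReal.tsum_le_tsum hlevel
    _ = ENNReal.ofReal (2 * (A ^ 2 * Q) * (2 * K) ^ p * r ^ p) := by
        rw [← ENNReal.ofReal_tsum_of_nonneg (fun n ↦ by positivity) hgeom.summable, hgeom.tsum_eq,
          mul_pow (2 * K)]
        congr 1
        ring

end Chaining

/-! ### Small balls of the standard Gaussian measure -/

section SmallBall

lemma gaussianReal_interval_inter_tail_le {g R : ℝ} (k : ℕ) :
    gaussianReal 0 1 {x | |x - g| ≤ R ∧ (k : ℝ) ≤ |x|}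
      ≤ ENNReal.ofReal (2 * R * Real.exp (-(k : ℝ) ^ 2 / 2)) := by
  have hsub : {x : ℝ | |x - g| ≤ R ∧ (k : ℝ) ≤ |x|} ⊆ Set.Icc (g - R) (g + R) := fun x hx ↦ by
    have := abs_le.1 hx.1
    constructor <;> linarith
  have hmeas : MeasurableSet {x : ℝ | |x - g| ≤ R ∧ (k : ℝ) ≤ |x|} :=
    MeasurableSet.inter (s₁ := {x : ℝ | |x - g| ≤ R}) (s₂ := {x : ℝ | (k : ℝ) ≤ |x|})
      (measurableSet_le (by fun_prop) (by fun_prop)) (measurableSet_le (by fun_prop) (by fun_prop))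
  rw [gaussianReal_apply _ one_ne_zero]
  calc ∫⁻ x in {x : ℝ | |x - g| ≤ R ∧ (k : ℝ) ≤ |x|}, gaussianPDF 0 1 x
      ≤ ∫⁻ _x in {x : ℝ | |x - g| ≤ R ∧ (k : ℝ) ≤ |x|},
          ENNReal.ofReal (Real.exp (-(k : ℝ) ^ 2 / 2)) := by
        refine setLIntegral_mono' hmeas fun x hx ↦ ENNReal.ofReal_le_ofReal ?_
        have h1 : (√(2 * Real.pi))⁻¹ ≤ 1 := by
          refine inv_le_one_of_one_le₀ (Real.one_le_sqrt.2 ?_)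
          linarith [Real.pi_gt_three]
        have h2 : (k : ℝ) ^ 2 ≤ x ^ 2 := by
          rw [← sq_abs x]
          exact pow_le_pow_left₀ (by positivity) hx.2 2
        simp only [gaussianPDFReal, NNReal.coe_one, mul_one, sub_zero]
        calc (√(2 * Real.pi))⁻¹ * Real.exp (-x ^ 2 / 2)
            ≤ 1 * Real.exp (-(k : ℝ) ^ 2 / 2) := by
              gcongr
          _ = _ := one_mul _
    _ = ENNReal.ofReal (Real.exp (-(k : ℝ) ^ 2 / 2))
          * volume {x : ℝ | |x - g| ≤ R ∧ (k : ℝ) ≤ |x|} := setLIntegral_const _ _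
    _ ≤ ENNReal.ofReal (Real.exp (-(k : ℝ) ^ 2 / 2)) * ENNReal.ofReal (2 * R) := by
        gcongr
        refine (measure_mono hsub).trans_eq ?_
        rw [Real.volume_Icc]
        congr 1
        ring
    _ = _ := by
        rw [← ENNReal.ofReal_mul (by positivity), mul_comm]

/-- The standard Gaussian measure of a box of side `2 * R`, with the Gaussian gain when the box is
cut off at distance `k` from the origin. -/
lemma pi_gaussianReal_box_inter_tail_le {d : ℕ} (g : Fin d → ℝ) {R : ℝ} (k : ℕ) (hR : 0 ≤ R) :
    Measure.pi (fun _ : Fin d ↦ gaussianReal 0 1)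
        {x | (∀ i, |x i - g i| ≤ R) ∧ ∃ i, (k : ℝ) ≤ |x i|}
      ≤ ENNReal.ofReal (d * ((2 * R) ^ d * Real.exp (-(k : ℝ) ^ 2 / 2))) := by
  have hsub : {x : Fin d → ℝ | (∀ i, |x i - g i| ≤ R) ∧ ∃ i, (k : ℝ) ≤ |x i|} ⊆
      ⋃ i : Fin d, Set.univ.pi fun j ↦
        {y | |y - g j| ≤ R ∧ (((if j = i then k else 0 : ℕ)) : ℝ) ≤ |y|} := by
    rintro x ⟨hx, i, hi⟩
    refine Set.mem_iUnion.2 ⟨i, fun j _ ↦ ⟨hx j, ?_⟩⟩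
    split_ifs with h
    · rwa [h]
    · simp
  refine (measure_mono hsub).trans ((measure_iUnion_fintype_le _ _).trans ?_)
  have hi : ∀ i : Fin d, Measure.pi (fun _ : Fin d ↦ gaussianReal 0 1) (Set.univ.pi fun j ↦
        {y | |y - g j| ≤ R ∧ (((if j = i then k else 0 : ℕ)) : ℝ) ≤ |y|})
      ≤ ENNReal.ofReal ((2 * R) ^ d * Real.exp (-(k : ℝ) ^ 2 / 2)) := by
    intro i
    rw [Measure.pi_pi]
    calc ∏ j : Fin d, gaussianReal 0 1
          {y | |y - g j| ≤ R ∧ (((if j = i then k else 0 : ℕ)) : ℝ) ≤ |y|}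
        ≤ ∏ j : Fin d, ENNReal.ofReal
            (2 * R * Real.exp (-(((if j = i then k else 0 : ℕ)) : ℝ) ^ 2 / 2)) :=
          Finset.prod_le_prod' fun j _ ↦ gaussianReal_interval_inter_tail_le _
      _ = ENNReal.ofReal ((2 * R) ^ d * Real.exp (-(k : ℝ) ^ 2 / 2)) := by
          rw [← ENNReal.ofReal_prod_of_nonneg fun j _ ↦ by positivity, Finset.prod_mul_distrib]
          congr 1
          rw [Finset.prod_const, Finset.card_univ, Fintype.card_fin, ← Real.exp_sum]
          congr 2
          rw [Finset.sum_eq_single i (fun j _ hj ↦ by simp [hj]) (by simp)]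
          simp
  refine (Finset.sum_le_card_nsmul _ _ _ fun i _ ↦ hi i).trans_eq ?_
  rw [nsmul_eq_mul, ENNReal.ofReal_mul (Nat.cast_nonneg d)]
  simp

lemma summable_pow_mul_exp_neg_sq (d : ℕ) :
    Summable fun k : ℕ ↦ ((k : ℝ) + 1) ^ d * Real.exp (-(k : ℝ) ^ 2 / 2) := by
  have h1 : Summable fun k : ℕ ↦ ((k + 1 : ℕ) : ℝ) ^ d * Real.exp (-1 * ((k + 1 : ℕ) : ℝ)) :=
    (summable_nat_add_iff 1).2 (Real.summable_pow_mul_exp_neg_nat_mul d one_pos)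
  refine Summable.of_nonneg_of_le (fun k ↦ by positivity) (fun k ↦ ?_)
    (h1.mul_left (Real.exp (3 / 2)))
  rw [mul_left_comm, ← Real.exp_add]
  push_cast
  gcongr
  nlinarith [sq_nonneg ((k : ℝ) - 1)]

/-- A small-ball estimate for a standard Gaussian vector `x`, uniform in the centre `g`, where the
radius may grow linearly with `x`: the growth is absorbed by the Gaussian tails, by slicing along
the integer part of the norm of `x`. -/
lemma exists_pi_gaussianReal_le {d : ℕ} (hd : d ≠ 0) : ∃ C : ℝ, 0 < C ∧
    ∀ (g : Fin d → ℝ) (a b : ℝ), 0 ≤ a → 0 ≤ b →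
      Measure.pi (fun _ : Fin d ↦ gaussianReal 0 1) {x | ∀ i, |x i - g i| ≤ a + b * ∑ j, |x j|}
        ≤ ENNReal.ofReal (C * (a + b) ^ d) := by
  have hd' : NeZero d := ⟨hd⟩
  have hsum := (summable_pow_mul_exp_neg_sq d).mul_left ((d : ℝ) * (2 * (d + 1)) ^ d)
  have hC0 : 0 < ∑' k : ℕ, (d : ℝ) * (2 * (d + 1)) ^ d *
      (((k : ℝ) + 1) ^ d * Real.exp (-(k : ℝ) ^ 2 / 2)) :=
    hsum.tsum_pos (fun k ↦ by positivity) 0 (by positivity)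
  refine ⟨_, hC0, fun g a b ha hb ↦ ?_⟩
  have hsub : {x : Fin d → ℝ | ∀ i, |x i - g i| ≤ a + b * ∑ j, |x j|} ⊆
      ⋃ k : ℕ, {x | (∀ i, |x i - g i| ≤ (a + b) * ((d + 1) * (k + 1))) ∧
        ∃ i, (k : ℝ) ≤ |x i|} := by
    intro x hx
    obtain ⟨i, -, hi⟩ := Finset.exists_max_image Finset.univ (fun i : Fin d ↦ |x i|)
      Finset.univ_nonempty
    refine Set.mem_iUnion.2 ⟨⌊|x i|⌋₊, fun j ↦ (hx j).trans ?_, i, Nat.floor_le (abs_nonneg _)⟩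
    have h1 : ∑ j, |x j| ≤ d * (⌊|x i|⌋₊ + 1) := by
      refine (Finset.sum_le_card_nsmul _ _ _ fun j hj ↦
        (hi j hj).trans (Nat.lt_floor_add_one (|x i|)).le).trans_eq ?_
      simp [mul_add]
    have h2 : b * ∑ j, |x j| ≤ b * (d * (⌊|x i|⌋₊ + 1)) := mul_le_mul_of_nonneg_left h1 hb
    have h3 : (0 : ℝ) ≤ ⌊|x i|⌋₊ := by positivity
    have h4 : (0 : ℝ) ≤ d := by positivity
    nlinarith [mul_nonneg ha h3, mul_nonneg ha h4, mul_nonneg hb h3, mul_nonneg hb h4,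
      mul_nonneg ha (mul_nonneg h3 h4)]
  refine (measure_mono hsub).trans ((measure_iUnion_le _).trans ?_)
  calc ∑' k : ℕ, Measure.pi (fun _ : Fin d ↦ gaussianReal 0 1)
        {x | (∀ i, |x i - g i| ≤ (a + b) * ((d + 1) * (k + 1))) ∧ ∃ i, (k : ℝ) ≤ |x i|}
      ≤ ∑' k : ℕ, ENNReal.ofReal ((d : ℝ) * (2 * (d + 1)) ^ d *
          (((k : ℝ) + 1) ^ d * Real.exp (-(k : ℝ) ^ 2 / 2)) * (a + b) ^ d) := by
        refine ENNReal.tsum_le_tsum fun k ↦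
          (pi_gaussianReal_box_inter_tail_le g k (by positivity)).trans_eq ?_
        congr 1
        simp only [mul_pow]
        ring
    _ = _ := by
        rw [← ENNReal.ofReal_tsum_of_nonneg (fun k ↦ by positivity) (hsum.mul_right _),
          tsum_mul_right]

end SmallBall

/-! ### Moments of Gaussian vectors -/

section Moments

variable {Ω : Type*} [MeasurableSpace Ω] {μ : Measure Ω} {d : ℕ}

lemma ennreal_sum_pow_le {ι : Type*} (s : Finset ι) (a : ι → ℝ≥0∞) {p : ℕ} (hp : p ≠ 0) :
    (∑ i ∈ s, a i) ^ p ≤ (s.card : ℝ≥0∞) ^ p * ∑ i ∈ s, a i ^ p := by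
  rcases s.eq_empty_or_nonempty with rfl | hs
  · simp [hp]
  obtain ⟨i, hi, hmax⟩ := Finset.exists_max_image s a hs
  calc (∑ i ∈ s, a i) ^ p ≤ (s.card * a i) ^ p := by
        gcongr
        rw [← nsmul_eq_mul]
        exact Finset.sum_le_card_nsmul _ _ _ hmax
    _ = (s.card : ℝ≥0∞) ^ p * a i ^ p := mul_pow _ _ _
    _ ≤ _ := by
        gcongr
        exact Finset.single_le_sum (f := fun i ↦ a i ^ p) (fun _ _ ↦ zero_le) hi

/-- The `p`-th absolute moment of the standard normal law. -/
noncomputable def absMoment (p : ℕ) : ℝ≥0∞ :=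
  ∫⁻ x, ENNReal.ofReal |x| ^ p ∂gaussianReal 0 1

lemma absMoment_ne_top (p : ℕ) : absMoment p ≠ ∞ := by
  rcases eq_or_ne p 0 with rfl | hp
  · simp [absMoment]
  have h := (memLp_id_gaussianReal (μ := 0) (v := 1) p).eLpNorm_lt_top
  have h2 := lintegral_rpow_enorm_lt_top_of_eLpNorm_lt_top (by simpa using hp) (by simp) h
  refine ne_of_lt (lt_of_eq_of_lt (lintegral_congr fun x ↦ ?_) h2)
  simp [← ofReal_norm]

lemma lintegral_abs_pow_gaussianReal (v : NNReal) (p : ℕ) :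
    ∫⁻ x, ENNReal.ofReal |x| ^ p ∂gaussianReal 0 v
      = ENNReal.ofReal (√v) ^ p * absMoment p := by
  have h : gaussianReal 0 v = (gaussianReal 0 1).map (√(v : ℝ) * ·) := by
    rw [gaussianReal_map_const_mul]
    congr 1
    · simp
    · ext
      simp [Real.sq_sqrt]
  rw [h, lintegral_map (by fun_prop) (by fun_prop), absMoment,
    ← lintegral_const_mul _ (by fun_prop)]
  refine lintegral_congr fun x ↦ ?_
  rw [abs_mul, abs_of_nonneg (Real.sqrt_nonneg _), ENNReal.ofReal_mul (Real.sqrt_nonneg _), mul_pow]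

lemma integral_inner_eq_zero {E : Type*} [NormedAddCommGroup E] [InnerProductSpace ℝ E]
    [CompleteSpace E] {Y : Ω → E} (hY : Integrable Y μ) (h0 : ∫ ω, Y ω ∂μ = 0) (y : E) :
    ∫ ω, inner ℝ y (Y ω) ∂μ = 0 := by
  rw [integral_inner hY, h0, inner_zero_right]

lemma map_eq_gaussianReal_of_centered {Y : Ω → ℝ} (hY : HasGaussianLaw Y μ)
    (h0 : ∫ ω, Y ω ∂μ = 0) : μ.map Y = gaussianReal 0 (∫ ω, Y ω ^ 2 ∂μ).toNNReal := by
  rw [hY.map_eq_gaussianReal, h0, variance_of_integral_eq_zero hY.aemeasurable h0]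

/-- A centered Gaussian vector has all its moments controlled by the second one. -/
lemma lintegral_norm_pow_le {Y : Ω → EuclideanSpace ℝ (Fin d)} (hY : HasGaussianLaw Y μ)
    (h0 : ∫ ω, Y ω ∂μ = 0) {p : ℕ} (hp : p ≠ 0) :
    ∫⁻ ω, ENNReal.ofReal ‖Y ω‖ ^ p ∂μ
      ≤ (d : ℝ≥0∞) ^ p * (d * absMoment p) * ENNReal.ofReal √(∫ ω, ‖Y ω‖ ^ 2 ∂μ) ^ p := by
  have := hY.isProbabilityMeasure
  have hcoord : ∀ j, HasGaussianLaw (fun ω ↦ Y ω j) μ := fun j ↦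
    hY.map_fun (EuclideanSpace.proj j : EuclideanSpace ℝ (Fin d) →L[ℝ] ℝ)
  have hcoord0 : ∀ j, ∫ ω, Y ω j ∂μ = 0 := by
    intro j
    have := (EuclideanSpace.proj j : EuclideanSpace ℝ (Fin d) →L[ℝ] ℝ).integral_comp_comm
      hY.integrable
    simpa [h0] using this
  have hj : ∀ j, ∫⁻ ω, ENNReal.ofReal |Y ω j| ^ p ∂μ
      ≤ absMoment p * ENNReal.ofReal √(∫ ω, ‖Y ω‖ ^ 2 ∂μ) ^ p := by
    intro j
    have h1 : ∫⁻ ω, ENNReal.ofReal |Y ω j| ^ p ∂μ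
        = ∫⁻ x, ENNReal.ofReal |x| ^ p ∂(μ.map fun ω ↦ Y ω j) :=
      (lintegral_map' (f := fun x : ℝ ↦ ENNReal.ofReal |x| ^ p) (by fun_prop)
        (hcoord j).aemeasurable).symm
    rw [h1, map_eq_gaussianReal_of_centered (hcoord j) (hcoord0 j),
      lintegral_abs_pow_gaussianReal, mul_comm]
    gcongr
    rw [Real.coe_toNNReal _ (integral_nonneg fun _ ↦ sq_nonneg _)]
    refine integral_mono (hcoord j).memLp_two.integrable_sq hY.memLp_two.integrable_norm_pow'
      fun ω ↦ ?_
    have := PiLp.norm_apply_le (Y ω) j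
    simp only
    rw [← sq_abs (Y ω j)]
    gcongr
    simpa using this
  have hnorm : ∀ ω, ENNReal.ofReal ‖Y ω‖ ≤ ∑ j, ENNReal.ofReal |Y ω j| := by
    intro ω
    rw [← ENNReal.ofReal_sum_of_nonneg fun _ _ ↦ abs_nonneg _]
    refine ENNReal.ofReal_le_ofReal ?_
    rw [EuclideanSpace.norm_eq]
    refine Real.sqrt_le_iff.2 ⟨Finset.sum_nonneg fun _ _ ↦ abs_nonneg _, ?_⟩
    simp only [Real.norm_eq_abs]
    exact Finset.sum_sq_le_sq_sum_of_nonneg fun _ _ ↦ abs_nonneg _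
  calc ∫⁻ ω, ENNReal.ofReal ‖Y ω‖ ^ p ∂μ
      ≤ ∫⁻ ω, (d : ℝ≥0∞) ^ p * ∑ j, ENNReal.ofReal |Y ω j| ^ p ∂μ := by
        refine lintegral_mono fun ω ↦ ?_
        refine (pow_le_pow_left' (hnorm ω) p).trans ((ennreal_sum_pow_le _ _ hp).trans_eq ?_)
        simp
    _ = (d : ℝ≥0∞) ^ p * ∑ j, ∫⁻ ω, ENNReal.ofReal |Y ω j| ^ p ∂μ := by
        rw [lintegral_const_mul' _ _ (ENNReal.pow_ne_top (ENNReal.natCast_ne_top d)),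
          lintegral_finsetSum' _ fun j _ ↦ ?_]
        exact (((hcoord j).aemeasurable.abs).ennreal_ofReal).pow_const p
    _ ≤ (d : ℝ≥0∞) ^ p * (d * (absMoment p * ENNReal.ofReal √(∫ ω, ‖Y ω‖ ^ 2 ∂μ) ^ p)) := by
        gcongr
        refine (Finset.sum_le_card_nsmul _ _ _ fun j _ ↦ hj j).trans_eq ?_
        simp
    _ = _ := by ring

end Moments

/-! ### Whitening a Gaussian vector -/

section Whitening

variable {Ω : Type*} [MeasurableSpace Ω] {μ : Measure Ω} {d : ℕ}

/-- Linear functionals that whiten a random vector: the `d` variables `⟪y i, Y⟫` are orthonormal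
in `L²`, and a lower bound on the covariance of `Y` bounds the norms of the `y i`. They come from
an orthogonal basis of the covariance form. -/
lemma exists_whitening {Y : Ω → EuclideanSpace ℝ (Fin d)} (hY : MemLp Y 2 μ) {l : ℝ} (hl : 0 < l)
    (hcov : ∀ e : EuclideanSpace ℝ (Fin d), ‖e‖ = 1 → l ≤ ∫ ω, (∑ j, e j * Y ω j) ^ 2 ∂μ) :
    ∃ y : Fin d → EuclideanSpace ℝ (Fin d), (∀ i, ‖y i‖ ≤ (√l)⁻¹) ∧
      ∀ i j, ∫ ω, inner ℝ (y i) (Y ω) * inner ℝ (y j) (Y ω) ∂μ = if i = j then 1 else 0 := by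
  have hint : ∀ x y : EuclideanSpace ℝ (Fin d),
      Integrable (fun ω ↦ inner ℝ x (Y ω) * inner ℝ y (Y ω)) μ := fun x y ↦
    (hY.const_inner x).integrable_mul (hY.const_inner y)
  let B : LinearMap.BilinForm ℝ (EuclideanSpace ℝ (Fin d)) :=
    LinearMap.mk₂ ℝ (fun x y ↦ ∫ ω, inner ℝ x (Y ω) * inner ℝ y (Y ω) ∂μ)
      (fun x x' y ↦ by
        simp only [inner_add_left, add_mul]
        exact integral_add (hint _ _) (hint _ _))
      (fun c x y ↦ by
        simp only [real_inner_smul_left, mul_assoc, smul_eq_mul]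
        exact integral_const_mul _ _)
      (fun x y y' ↦ by
        simp only [inner_add_left, mul_add]
        exact integral_add (hint _ _) (hint _ _))
      (fun c x y ↦ by
        simp only [real_inner_smul_left, mul_left_comm _ c, smul_eq_mul]
        exact integral_const_mul _ _)
  have hBapp : ∀ x y, B x y = ∫ ω, inner ℝ x (Y ω) * inner ℝ y (Y ω) ∂μ := fun x y ↦ rfl
  have hBsymm : LinearMap.IsSymm B := ⟨fun x y ↦ by
    simp only [hBapp, RingHom.id_apply]
    exact integral_congr_ae (ae_of_all _ fun ω ↦ mul_comm _ _)⟩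
  have hBlow : ∀ x, l * ‖x‖ ^ 2 ≤ B x x := by
    intro x
    rcases eq_or_ne x 0 with rfl | hx
    · simp
    have h1 := hcov (‖x‖⁻¹ • x) (norm_smul_inv_norm hx)
    have h2 : ∫ ω, (∑ j, (‖x‖⁻¹ • x) j * Y ω j) ^ 2 ∂μ = (‖x‖⁻¹) ^ 2 * B x x := by
      rw [hBapp, ← integral_const_mul]
      refine integral_congr_ae (ae_of_all _ fun ω ↦ ?_)
      simp only [PiLp.smul_apply, smul_eq_mul, mul_assoc, ← Finset.mul_sum, mul_pow]
      rw [PiLp.inner_apply, ← sq]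
      simp [mul_comm]
    rw [h2, inv_pow, inv_mul_eq_div, le_div_iff₀ (by positivity)] at h1
    exact h1
  obtain ⟨v, hv⟩ := LinearMap.BilinForm.exists_orthogonal_basis hBsymm
  let v' := v.reindex (finCongr (finrank_euclideanSpace_fin (𝕜 := ℝ) (n := d)))
  have hv' : ∀ i j, i ≠ j → B (v' i) (v' j) = 0 := by
    intro i j hij
    simp only [v', Module.Basis.reindex_apply]
    exact hv (by simpa using hij)
  have hpos : ∀ i, 0 < B (v' i) (v' i) := fun i ↦
    lt_of_lt_of_le (by have := norm_pos_iff.2 (v'.ne_zero i); positivity) (hBlow (v' i))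
  let y := fun i ↦ (√(B (v' i) (v' i)))⁻¹ • v' i
  have hy : ∀ i j, B (y i) (y j) = if i = j then 1 else 0 := by
    intro i j
    simp only [y, map_smul, LinearMap.smul_apply, smul_eq_mul]
    split_ifs with h
    · subst h
      have := hpos i
      rw [← mul_assoc, ← mul_inv, Real.mul_self_sqrt this.le, inv_mul_cancel₀ this.ne']
    · simp [hv' i j h]
  refine ⟨y, fun i ↦ ?_, fun i j ↦ hy i j⟩
  have h1 := hBlow (y i)
  rw [hy, if_pos rfl] at h1
  rw [← Real.sqrt_inv]
  refine Real.le_sqrt_of_sq_le ?_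
  rwa [← one_div, le_div_iff₀ hl, mul_comm]

lemma map_inner_eq_gaussianReal {Y : Ω → EuclideanSpace ℝ (Fin d)} (hY : HasGaussianLaw Y μ)
    (h0 : ∫ ω, Y ω ∂μ = 0) {y : EuclideanSpace ℝ (Fin d)}
    (hy : ∫ ω, inner ℝ y (Y ω) * inner ℝ y (Y ω) ∂μ = 1) :
    μ.map (fun ω ↦ inner ℝ y (Y ω)) = gaussianReal 0 1 := by
  have hG : HasGaussianLaw (fun ω ↦ inner ℝ y (Y ω)) μ := hY.map_fun (innerSL ℝ y)
  rw [map_eq_gaussianReal_of_centered hG (integral_inner_eq_zero hY.integrable h0 y)]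
  simp only [← sq] at hy
  simp [hy]

lemma map_whitening_eq {Y : Ω → EuclideanSpace ℝ (Fin d)} (hY : HasGaussianLaw Y μ)
    (h0 : ∫ ω, Y ω ∂μ = 0) {y : Fin d → EuclideanSpace ℝ (Fin d)}
    (hy : ∀ i j, ∫ ω, inner ℝ (y i) (Y ω) * inner ℝ (y j) (Y ω) ∂μ = if i = j then 1 else 0) :
    μ.map (fun ω i ↦ inner ℝ (y i) (Y ω)) = Measure.pi fun _ : Fin d ↦ gaussianReal 0 1 := by
  have := hY.isProbabilityMeasure
  have hG : HasGaussianLaw (fun ω i ↦ inner ℝ (y i) (Y ω)) μ :=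
    hY.map_fun (ContinuousLinearMap.pi fun i ↦ innerSL ℝ (y i))
  have hG0 : ∀ i, ∫ ω, inner ℝ (y i) (Y ω) ∂μ = 0 := fun i ↦
    integral_inner_eq_zero hY.integrable h0 _
  have hind : iIndepFun (fun i ω ↦ inner ℝ (y i) (Y ω)) μ := by
    refine HasGaussianLaw.iIndepFun_of_covariance_eq_zero hG fun i j hij ↦ ?_
    rw [covariance_eq_sub (hG.eval i).memLp_two (hG.eval j).memLp_two, hG0, zero_mul, sub_zero]
    simpa [hij] using hy i j
  rw [(iIndepFun_iff_map_fun_eq_pi_map fun i ↦ (hG.eval i).aemeasurable).1 hind]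
  congr 1
  ext1 i
  exact map_inner_eq_gaussianReal hY h0 (by simpa using hy i i)

end Whitening

/-! ### Regression of the field on its value at one point -/

section Regression

variable {Ω T : Type*} [MeasurableSpace Ω] {d : ℕ}

/-- The coefficient `E[⟪y, X t⟫ X s]` of `X s` in its regression on `⟪y, X t⟫`. -/
noncomputable def regressionCoeff (μ : Measure Ω) (X : T → Ω → EuclideanSpace ℝ (Fin d)) (t : T)
    (y : EuclideanSpace ℝ (Fin d)) (s : T) : EuclideanSpace ℝ (Fin d) :=
  ∫ ω, inner ℝ y (X t ω) • X s ω ∂μ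

/-- The residual of `X s` after regression on the variables `⟪y i, X t⟫`. -/
noncomputable def residual (μ : Measure Ω) (X : T → Ω → EuclideanSpace ℝ (Fin d)) (t : T)
    (y : Fin d → EuclideanSpace ℝ (Fin d)) (s : T) (ω : Ω) : EuclideanSpace ℝ (Fin d) :=
  X s ω - ∑ i, inner ℝ (y i) (X t ω) • regressionCoeff μ X t (y i) s

variable {μ : Measure Ω} {X : T → Ω → EuclideanSpace ℝ (Fin d)} {t : T}
  {y : Fin d → EuclideanSpace ℝ (Fin d)}

lemma norm_regressionCoeff_sub_le (hX : ∀ s, MemLp (X s) 2 μ) {y : EuclideanSpace ℝ (Fin d)}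
    (hy : ∫ ω, inner ℝ y (X t ω) * inner ℝ y (X t ω) ∂μ = 1) (s u : T) :
    ‖regressionCoeff μ X t y s - regressionCoeff μ X t y u‖
      ≤ √(∫ ω, ‖X s ω - X u ω‖ ^ 2 ∂μ) := by
  have hG : MemLp (fun ω ↦ inner ℝ y (X t ω)) 2 μ := (hX t).const_inner y
  have hint : ∀ s, Integrable (fun ω ↦ inner ℝ y (X t ω) • X s ω) μ := fun s ↦
    memLp_one_iff_integrable.1 ((hX s).smul hG)
  have hconj : (2 : ℝ).HolderConjugate 2 := Real.HolderConjugate.two_two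
  rw [regressionCoeff, regressionCoeff, ← integral_sub (hint s) (hint u)]
  calc ‖∫ ω, (inner ℝ y (X t ω) • X s ω - inner ℝ y (X t ω) • X u ω) ∂μ‖
      ≤ ∫ ω, ‖inner ℝ y (X t ω) • X s ω - inner ℝ y (X t ω) • X u ω‖ ∂μ :=
        norm_integral_le_integral_norm _
    _ = ∫ ω, |inner ℝ y (X t ω)| * ‖X s ω - X u ω‖ ∂μ := by
        refine integral_congr_ae (ae_of_all _ fun ω ↦ ?_)
        simp only [← smul_sub, norm_smul, Real.norm_eq_abs]
    _ ≤ (∫ ω, |inner ℝ y (X t ω)| ^ (2 : ℝ) ∂μ) ^ (1 / (2 : ℝ))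
          * (∫ ω, ‖X s ω - X u ω‖ ^ (2 : ℝ) ∂μ) ^ (1 / (2 : ℝ)) :=
        integral_mul_le_Lp_mul_Lq_of_nonneg hconj (ae_of_all _ fun _ ↦ abs_nonneg _)
          (ae_of_all _ fun _ ↦ norm_nonneg _) (by simpa using hG.norm)
          (by simpa using ((hX s).sub (hX u)).norm)
    _ = √(∫ ω, ‖X s ω - X u ω‖ ^ 2 ∂μ) := by
        have h1 : ∫ ω, |inner ℝ y (X t ω)| ^ (2 : ℝ) ∂μ = 1 := by
          simp only [Real.rpow_two, sq_abs]
          simpa only [sq] using hy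
        rw [h1, Real.one_rpow, one_mul, Real.sqrt_eq_rpow]
        simp only [Real.rpow_two]

lemma norm_sum_smul_le {ι E : Type*} [Fintype ι] [NormedAddCommGroup E] [NormedSpace ℝ E]
    {v : ι → E} {b : ℝ} (hb : ∀ i, ‖v i‖ ≤ b) (a : ι → ℝ) :
    ‖∑ i, a i • v i‖ ≤ b * ∑ i, |a i| := by
  refine (norm_sum_le _ _).trans ?_
  rw [Finset.mul_sum]
  refine Finset.sum_le_sum fun i _ ↦ ?_
  rw [norm_smul, Real.norm_eq_abs, mul_comm]
  exact mul_le_mul_of_nonneg_right (hb i) (abs_nonneg _)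

lemma norm_sub_le_residual_add {b : ℝ} {s u : T}
    (hb : ∀ i, ‖regressionCoeff μ X t (y i) s - regressionCoeff μ X t (y i) u‖ ≤ b) (ω : Ω) :
    ‖X s ω - X u ω‖ ≤ ‖residual μ X t y s ω - residual μ X t y u ω‖
      + b * ∑ i, |inner ℝ (y i) (X t ω)| := by
  have h : X s ω - X u ω = (residual μ X t y s ω - residual μ X t y u ω)
      + ∑ i, inner ℝ (y i) (X t ω) •
        (regressionCoeff μ X t (y i) s - regressionCoeff μ X t (y i) u) := by
    simp only [residual, smul_sub, Finset.sum_sub_distrib]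
    abel
  rw [h]
  exact (norm_add_le _ _).trans (add_le_add_right (norm_sum_smul_le hb _) _)

lemma norm_residual_sub_le {b : ℝ} {s u : T}
    (hb : ∀ i, ‖regressionCoeff μ X t (y i) s - regressionCoeff μ X t (y i) u‖ ≤ b) (ω : Ω) :
    ‖residual μ X t y s ω - residual μ X t y u ω‖ ≤ ‖X s ω - X u ω‖
      + b * ∑ i, |inner ℝ (y i) (X t ω)| := by
  have h : residual μ X t y s ω - residual μ X t y u ω = (X s ω - X u ω)
      - ∑ i, inner ℝ (y i) (X t ω) •
        (regressionCoeff μ X t (y i) s - regressionCoeff μ X t (y i) u) := by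
    simp only [residual, smul_sub, Finset.sum_sub_distrib]
    abel
  rw [h]
  exact (norm_sub_le _ _).trans (add_le_add_right (norm_sum_smul_le hb _) _)

lemma aemeasurable_residual (hX : ∀ s, AEMeasurable (X s) μ) (s : T) :
    AEMeasurable (residual μ X t y s) μ :=
  (hX s).sub (Finset.aemeasurable_fun_sum _ fun _ _ ↦ ((hX t).const_inner).smul_const _)

/-- The residual process is independent of the whitened coordinates of `X t`: both are linear
images of the Gaussian process `X`, and they are uncorrelated by the choice of the regression
coefficients. -/
lemma indepFun_residual (hX : IsGaussianProcess X μ) (h0 : ∀ s, ∫ ω, X s ω ∂μ = 0)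
    (hy : ∀ i j, ∫ ω, inner ℝ (y i) (X t ω) * inner ℝ (y j) (X t ω) ∂μ = if i = j then 1 else 0) :
    IndepFun (fun ω (q : T × Fin d) ↦ residual μ X t y q.1 ω q.2)
      (fun ω i ↦ inner ℝ (y i) (X t ω)) μ := by
  classical
  have := hX.isProbabilityMeasure
  have hXL := fun s ↦ (hX.hasGaussianLaw_eval s).memLp_two
  have hG : ∀ i, MemLp (fun ω ↦ inner ℝ (y i) (X t ω)) 2 μ := fun i ↦ (hXL t).const_inner (y i)
  let π (j : Fin d) : EuclideanSpace ℝ (Fin d) →L[ℝ] ℝ := EuclideanSpace.proj j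
  have hXj : ∀ s (j : Fin d), MemLp (fun ω ↦ X s ω j) 2 μ := fun s j ↦
    ((hX.hasGaussianLaw_eval s).map_fun (π j)).memLp_two
  have hcoeff : ∀ i s (j : Fin d),
      regressionCoeff μ X t (y i) s j = ∫ ω, inner ℝ (y i) (X t ω) * X s ω j ∂μ := by
    intro i s j
    have hint : Integrable (fun ω ↦ inner ℝ (y i) (X t ω) • X s ω) μ :=
      memLp_one_iff_integrable.1 ((hXL s).smul (hG i))
    have := (π j).integral_comp_comm hint
    simpa [π, regressionCoeff] using this.symm
  have hres : ∀ (q : T × Fin d) ω, residual μ X t y q.1 ω q.2 = X q.1 ω q.2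
      - ∑ i, inner ℝ (y i) (X t ω) * regressionCoeff μ X t (y i) q.1 q.2 := by
    intro q ω
    simp [residual]
  have hproc : IsGaussianProcess (Sum.elim
      (fun (q : T × Fin d) ω ↦ residual μ X t y q.1 ω q.2)
      (fun i ω ↦ inner ℝ (y i) (X t ω))) μ := by
    refine hX.of_isGaussianProcess fun q ↦ ?_
    rcases q with q | i
    · refine ⟨{q.1, t}, π q.2 ∘L ContinuousLinearMap.proj ⟨q.1, by simp⟩
        - ∑ i, regressionCoeff μ X t (y i) q.1 q.2 •
          (innerSL ℝ (y i) ∘L ContinuousLinearMap.proj ⟨t, by simp⟩), fun ω ↦ ?_⟩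
      simp [hres, π, mul_comm]
    · exact ⟨{t}, innerSL ℝ (y i) ∘L ContinuousLinearMap.proj ⟨t, by simp⟩, fun ω ↦ by simp⟩
  have hZ : ∀ q : T × Fin d, HasGaussianLaw (fun ω ↦ residual μ X t y q.1 ω q.2) μ := fun q ↦
    hproc.hasGaussianLaw_eval (Sum.inl q)
  refine hproc.indepFun_of_covariance_eq_zero (fun q ↦ (hZ q).aemeasurable)
    (fun i ↦ (hG i).aemeasurable) fun q k ↦ ?_
  rw [covariance_eq_sub (hZ q).memLp_two (hG k),
    integral_inner_eq_zero (hX.hasGaussianLaw_eval t).integrable (h0 t), mul_zero, sub_zero]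
  have hexp : ∀ ω, residual μ X t y q.1 ω q.2 * inner ℝ (y k) (X t ω)
      = inner ℝ (y k) (X t ω) * X q.1 ω q.2 - ∑ i, regressionCoeff μ X t (y i) q.1 q.2 *
        (inner ℝ (y i) (X t ω) * inner ℝ (y k) (X t ω)) := by
    intro ω
    rw [hres, sub_mul, Finset.sum_mul]
    congr 1
    · ring
    · exact Finset.sum_congr rfl fun i _ ↦ by ring
  have hint : ∀ i, Integrable (fun ω ↦ regressionCoeff μ X t (y i) q.1 q.2 *
      (inner ℝ (y i) (X t ω) * inner ℝ (y k) (X t ω))) μ := fun i ↦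
    ((hG i).integrable_mul (hG k)).const_mul _
  have hint' : Integrable (fun ω ↦ inner ℝ (y k) (X t ω) * X q.1 ω q.2) μ :=
    (hG k).integrable_mul (hXj q.1 q.2)
  calc ∫ ω, residual μ X t y q.1 ω q.2 * inner ℝ (y k) (X t ω) ∂μ
      = ∫ ω, (inner ℝ (y k) (X t ω) * X q.1 ω q.2
          - ∑ i, regressionCoeff μ X t (y i) q.1 q.2 *
            (inner ℝ (y i) (X t ω) * inner ℝ (y k) (X t ω))) ∂μ :=
        integral_congr_ae (ae_of_all _ hexp)
    _ = 0 := by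
        rw [integral_sub hint' (integrable_finsetSum _ fun i _ ↦ hint i),
          integral_finsetSum _ fun i _ ↦ hint i]
        simp only [integral_const_mul, hy, mul_ite, mul_one, mul_zero]
        rw [Finset.sum_ite_eq' Finset.univ k, if_pos (Finset.mem_univ k), hcoeff, sub_self]

/-- All moments of the increments of the residual process are controlled by its scale `b`. -/
lemma lintegral_residual_sub_pow_le (hX : IsGaussianProcess X μ) (h0 : ∀ s, ∫ ω, X s ω ∂μ = 0)
    (hy : ∀ i j, ∫ ω, inner ℝ (y i) (X t ω) * inner ℝ (y j) (X t ω) ∂μ = if i = j then 1 else 0)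
    {p : ℕ} (hp : p ≠ 0) {s u : T} {b : ℝ} (hb : √(∫ ω, ‖X s ω - X u ω‖ ^ 2 ∂μ) ≤ b) :
    ∫⁻ ω, ENNReal.ofReal ‖residual μ X t y s ω - residual μ X t y u ω‖ ^ p ∂μ
      ≤ ((d : ℝ≥0∞) + 1) ^ p * ((d : ℝ≥0∞) ^ p * (d * absMoment p) + d * absMoment p)
        * ENNReal.ofReal b ^ p := by
  have hXL := fun s ↦ (hX.hasGaussianLaw_eval s).memLp_two
  have hXi := fun s ↦ (hX.hasGaussianLaw_eval s).integrable
  have hb0 : 0 ≤ b := (Real.sqrt_nonneg _).trans hb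
  have hcoeff : ∀ i, ‖regressionCoeff μ X t (y i) s - regressionCoeff μ X t (y i) u‖ ≤ b := fun i ↦
    (norm_regressionCoeff_sub_le hXL (by simpa using hy i i) s u).trans hb
  have hG : ∀ i, AEMeasurable (fun ω ↦ inner ℝ (y i) (X t ω)) μ := fun i ↦
    ((hXL t).const_inner (y i)).aemeasurable
  have hGm : ∀ i, ∫⁻ ω, ENNReal.ofReal |inner ℝ (y i) (X t ω)| ^ p ∂μ = absMoment p := by
    intro i
    rw [absMoment, ← map_inner_eq_gaussianReal (hX.hasGaussianLaw_eval t) (h0 t)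
      (y := y i) (by simpa using hy i i), lintegral_map' (by fun_prop) (hG i)]
  have hinc : ∫⁻ ω, ENNReal.ofReal ‖X s ω - X u ω‖ ^ p ∂μ
      ≤ (d : ℝ≥0∞) ^ p * (d * absMoment p) * ENNReal.ofReal b ^ p := by
    refine (lintegral_norm_pow_le hX.hasGaussianLaw_fun_sub ?_ hp).trans ?_
    · rw [integral_sub (hXi s) (hXi u), h0, h0, sub_zero]
    · gcongr
  have hpt : ∀ ω, ENNReal.ofReal ‖residual μ X t y s ω - residual μ X t y u ω‖ ^ p
      ≤ ((d : ℝ≥0∞) + 1) ^ p * (ENNReal.ofReal ‖X s ω - X u ω‖ ^ p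
        + ∑ i, ENNReal.ofReal b ^ p * ENNReal.ofReal |inner ℝ (y i) (X t ω)| ^ p) := by
    intro ω
    let a : Option (Fin d) → ℝ≥0∞ := fun o ↦ o.elim (ENNReal.ofReal ‖X s ω - X u ω‖)
      fun i ↦ ENNReal.ofReal b * ENNReal.ofReal |inner ℝ (y i) (X t ω)|
    have h1 : ENNReal.ofReal ‖residual μ X t y s ω - residual μ X t y u ω‖ ≤ ∑ o, a o := by
      refine (ENNReal.ofReal_le_ofReal (norm_residual_sub_le hcoeff ω)).trans ?_
      rw [ENNReal.ofReal_add (norm_nonneg _)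
        (mul_nonneg hb0 (Finset.sum_nonneg fun _ _ ↦ abs_nonneg _)), ENNReal.ofReal_mul hb0,
        ENNReal.ofReal_sum_of_nonneg fun _ _ ↦ abs_nonneg _, Finset.mul_sum, Fintype.sum_option]
      exact le_rfl
    refine (pow_le_pow_left' h1 p).trans ((ennreal_sum_pow_le _ a hp).trans_eq ?_)
    simp [a, Fintype.sum_option, mul_pow]
  have hXm : AEMeasurable (fun ω ↦ ENNReal.ofReal ‖X s ω - X u ω‖ ^ p) μ :=
    (((hX.aemeasurable s).sub (hX.aemeasurable u)).norm.ennreal_ofReal).pow_const p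
  have hbt : ENNReal.ofReal b ^ p ≠ ∞ := ENNReal.pow_ne_top ENNReal.ofReal_ne_top
  calc ∫⁻ ω, ENNReal.ofReal ‖residual μ X t y s ω - residual μ X t y u ω‖ ^ p ∂μ
      ≤ ∫⁻ ω, ((d : ℝ≥0∞) + 1) ^ p * (ENNReal.ofReal ‖X s ω - X u ω‖ ^ p
        + ∑ i, ENNReal.ofReal b ^ p * ENNReal.ofReal |inner ℝ (y i) (X t ω)| ^ p) ∂μ :=
        lintegral_mono hpt
    _ = ((d : ℝ≥0∞) + 1) ^ p * (∫⁻ ω, ENNReal.ofReal ‖X s ω - X u ω‖ ^ p ∂μ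
        + ∑ _i : Fin d, ENNReal.ofReal b ^ p * absMoment p) := by
        rw [lintegral_const_mul' _ _ (ENNReal.pow_ne_top (by finiteness)), lintegral_add_left' hXm,
          lintegral_finsetSum' _ fun i _ ↦
            (((hG i).abs.ennreal_ofReal).pow_const p).const_mul _]
        simp only [lintegral_const_mul' _ _ hbt, hGm]
    _ ≤ ((d : ℝ≥0∞) + 1) ^ p * ((d : ℝ≥0∞) ^ p * (d * absMoment p) * ENNReal.ofReal b ^ p
        + ∑ _i : Fin d, ENNReal.ofReal b ^ p * absMoment p) := by gcongr
    _ = _ := by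
        rw [Finset.sum_const, Finset.card_univ, Fintype.card_fin, nsmul_eq_mul]
        ring

end Regression

/-! ### Continuity of the paths -/

section Modulus

/-- A finite modulus of continuity `ε √(log (1 / ε))` implies uniform continuity, since
`ε √(log (1 / ε)) ≤ √ε`. -/
lemma uniformContinuous_of_limsup_modulus {N d : ℕ} {H : Fin N → ℝ} {I : Set (Fin N → ℝ)}
    {x : I → EuclideanSpace ℝ (Fin d)} {c' : ℝ}
    (h : limsup (fun ε : ℝ => ⨆ (s : I) (t : I) (_ : rho H s t ≤ ε),
      ENNReal.ofReal (‖x s - x t‖ / (ε * √(Real.log ε⁻¹)))) (𝓝[>] (0 : ℝ)) ≤ ENNReal.ofReal c')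
    {ε : ℝ} (hε : 0 < ε) : ∃ δ > 0, ∀ u s : I, rho H u s < δ → ‖x u - x s‖ < ε := by
  set M : ℝ := max c' 0 + 1 with hM
  have hM0 : 0 < M := by positivity
  have hlt : ENNReal.ofReal c' < ENNReal.ofReal M :=
    (ENNReal.ofReal_lt_ofReal_iff hM0).2 (by linarith [le_max_left c' 0])
  have h1 := eventually_lt_of_limsup_lt (h.trans_lt hlt)
  have h2 : ∀ᶠ η : ℝ in 𝓝[>] 0, M * √η < ε := by
    have : Tendsto (fun η : ℝ ↦ M * √η) (𝓝[>] 0) (𝓝 (M * √0)) :=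
      (Continuous.tendsto (by fun_prop) 0).mono_left nhdsWithin_le_nhds
    rw [Real.sqrt_zero, mul_zero] at this
    exact this.eventually (gt_mem_nhds hε)
  have h3 : ∀ᶠ η : ℝ in 𝓝[>] 0, η ∈ Set.Ioo (0 : ℝ) 1 := Ioo_mem_nhdsGT one_pos
  obtain ⟨η, hη1, hη2, hη0, hη3⟩ := (h1.and (h2.and h3)).exists
  refine ⟨η, hη0, fun u s hus ↦ lt_of_le_of_lt ?_ hη2⟩
  have h4 : ENNReal.ofReal (‖x u - x s‖ / (η * √(Real.log η⁻¹))) ≤ ENNReal.ofReal M := by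
    refine le_trans (le_iSup_of_le u (le_iSup_of_le s ?_)) hη1.le
    rw [iSup_pos hus.le]
  have hlog : 0 < Real.log η⁻¹ := Real.log_pos ((one_lt_inv₀ hη0).2 hη3)
  rw [ENNReal.ofReal_le_ofReal_iff hM0.le, div_le_iff₀ (by positivity)] at h4
  refine h4.trans (mul_le_mul_of_nonneg_left ?_ hM0.le)
  have h5 : Real.log η⁻¹ ≤ η⁻¹ := (Real.log_le_sub_one_of_pos (inv_pos.2 hη0)).trans (by linarith)
  calc η * √(Real.log η⁻¹) ≤ η * √η⁻¹ := by gcongr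
    _ = √η := by
        rw [Real.sqrt_inv, ← div_eq_mul_inv, Real.div_sqrt]

end Modulus

/-! ### The hitting estimate -/

section Hitting

variable {Ω : Type*} [MeasurableSpace Ω] {μ : Measure Ω}

/-- Conditioning on one of two independent variables, as an inequality. -/
lemma measure_le_lintegral_of_indepFun [IsProbabilityMeasure μ] {α β : Type*} [MeasurableSpace α]
    [MeasurableSpace β] {W : Ω → α} {G : Ω → β} (h : IndepFun W G μ) (hW : AEMeasurable W μ)
    (hG : AEMeasurable G μ) {S : Set (α × β)} (hS : MeasurableSet S) {B : α → ℝ≥0∞}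
    (hB : ∀ w, μ.map G (Prod.mk w ⁻¹' S) ≤ B w) :
    μ {ω | (W ω, G ω) ∈ S} ≤ ∫⁻ ω, B (W ω) ∂μ := by
  have := Measure.isProbabilityMeasure_map hG (μ := μ)
  have := Measure.isProbabilityMeasure_map hW (μ := μ)
  calc μ {ω | (W ω, G ω) ∈ S} = μ.map (fun ω ↦ (W ω, G ω)) S :=
        (Measure.map_apply_of_aemeasurable (hW.prodMk hG) hS).symm
    _ = ∫⁻ ω, μ.map G (Prod.mk (W ω) ⁻¹' S) ∂μ := by
        rw [(indepFun_iff_map_prod_eq_prod_map_map hW hG).1 h, Measure.prod_apply hS,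
          lintegral_map' (measurable_measure_prodMk_left hS).aemeasurable hW]
    _ ≤ _ := lintegral_mono fun ω ↦ hB (W ω)

/-- Interpolation between `d`-th and `p`-th powers at the scale `r`: a random variable `w` with
expectation `O(r ^ p)` contributes `O(r ^ d)` to the left-hand side. -/
lemma add_rpow_pow_le {a r w : ℝ} (ha : 0 ≤ a) (hr : 0 < r) (hw : 0 ≤ w) {d p : ℕ} (hdp : d ≤ p)
    (hp : p ≠ 0) :
    (a * r + 2 * w ^ (p : ℝ)⁻¹) ^ d ≤ (2 * (a + 2)) ^ d * r ^ d * (1 + w / r ^ p) := by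
  set x := w ^ (p : ℝ)⁻¹ / r with hx
  have hx0 : 0 ≤ x := by positivity
  have h1 : w ^ (p : ℝ)⁻¹ = x * r := by rw [hx]; field_simp
  have h2 : w / r ^ p = x ^ p := by
    rw [hx, div_pow, Real.rpow_inv_natCast_pow hw hp]
  have h3 : (1 + x) ^ d ≤ 2 ^ d * (1 + x ^ p) := by
    rcases le_total x 1 with h | h
    · calc (1 + x) ^ d ≤ 2 ^ d := by gcongr; linarith
        _ ≤ _ := le_mul_of_one_le_right (by positivity) (by linarith [pow_nonneg hx0 p])
    · calc (1 + x) ^ d ≤ (2 * x) ^ d := by gcongr; linarith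
        _ = 2 ^ d * x ^ d := mul_pow _ _ _
        _ ≤ 2 ^ d * (1 + x ^ p) := by
          gcongr
          linarith [pow_le_pow_right₀ h hdp]
  rw [h1, h2]
  calc (a * r + 2 * (x * r)) ^ d ≤ ((a + 2) * r * (1 + x)) ^ d := by
        gcongr
        nlinarith [mul_nonneg ha (mul_nonneg hr.le hx0)]
    _ = (a + 2) ^ d * r ^ d * (1 + x) ^ d := by rw [mul_pow, mul_pow]
    _ ≤ (a + 2) ^ d * r ^ d * (2 ^ d * (1 + x ^ p)) := by gcongr
    _ = _ := by rw [mul_pow]; ring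

/-- The residuals inherit the continuity of the paths of `X`. -/
lemma residual_continuous {N d : ℕ} {H : Fin N → ℝ} {I : Set (Fin N → ℝ)}
    {X : I → Ω → EuclideanSpace ℝ (Fin d)} {t : I} {y : Fin d → EuclideanSpace ℝ (Fin d)}
    {c c' : ℝ} (hc : 0 < c) (hcoeff : ∀ u s i,
      ‖regressionCoeff μ X t (y i) u - regressionCoeff μ X t (y i) s‖ ≤ c * rho H u s) {ω : Ω}
    (hω : limsup (fun ε : ℝ => ⨆ (s : I) (t : I) (_ : rho H s t ≤ ε),
      ENNReal.ofReal (‖X s ω - X t ω‖ / (ε * √(Real.log ε⁻¹)))) (𝓝[>] (0 : ℝ))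
        ≤ ENNReal.ofReal c') (s : I) {ε : ℝ} (hε : 0 < ε) :
    ∃ δ > 0, ∀ u : I, rho H u s < δ → ‖residual μ X t y u ω - residual μ X t y s ω‖ < ε := by
  obtain ⟨δ, hδ, hδX⟩ := uniformContinuous_of_limsup_modulus (x := fun s ↦ X s ω) hω (half_pos hε)
  set σ : ℝ := ∑ j, |inner ℝ (y j) (X t ω)| with hσ
  have hσ0 : 0 ≤ σ := Finset.sum_nonneg fun _ _ ↦ abs_nonneg _
  refine ⟨min δ (ε / 2 / (c * (σ + 1))), lt_min hδ (by positivity), fun u hu ↦ ?_⟩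
  have h1 := hδX u s (hu.trans_le (min_le_left _ _))
  have h2 : rho H u s < ε / 2 / (c * (σ + 1)) := hu.trans_le (min_le_right _ _)
  rw [lt_div_iff₀ (by positivity)] at h2
  have h3 := norm_residual_sub_le (hcoeff u s) ω
  rw [← hσ] at h3
  have h4 := mul_nonneg hc.le (rho_nonneg (H := H) u s)
  nlinarith

end Hitting

end AnisotropicField

theorem lemma1 {N d : ℕ} {Ω : Type*} [MeasurableSpace Ω] (μ : Measure Ω) [IsProbabilityMeasure μ]
    (H : Fin N → ℝ) (hH : ∀ j, 0 < H j ∧ H j ≤ 1)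
    (I : Set (Fin N → ℝ)) (hI : Bornology.IsBounded I)
    (X : I → Ω → EuclideanSpace ℝ (Fin d))
    (hX : AnisotropicField.IsCenteredGaussianField μ I X)
    (hmod : AnisotropicField.HasUniformModulus μ H I X)
    (hmetric : AnisotropicField.CanonicalMetricBound μ H I X)
    (heig : AnisotropicField.CovarianceLowerBound μ I X) :
    ∀ L : ℝ, 0 ≤ L → ∃ C : ℝ, 0 < C ∧
      ∀ (t : I) (r : ℝ), 0 < r → ∀ f ∈ AnisotropicField.LipRho (d := d) H I L,
        μ {ω | (⨅ s : {s : I // (s : Fin N → ℝ) ∈ AnisotropicField.closedBallRho H t r},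
            ‖X s.1 ω - f s.1‖) ≤ r} ≤ ENNReal.ofReal (C * r ^ d) := by
  open AnisotropicField in
  intro L hL
  -- For `d = 0` the bound `C * r ^ 0` is constant.
  rcases eq_or_ne d 0 with rfl | hd
  · exact ⟨1, one_pos, fun t r hr f hf ↦ by simpa using prob_le_one⟩
  obtain ⟨c, hc, hmetric⟩ := hmetric
  obtain ⟨l, hl, heig⟩ := heig
  obtain ⟨c', -, hmod⟩ := hmod
  obtain ⟨A, Q, hA, hQ, hnet⟩ := exists_net (H := H) fun j ↦ (hH j).1
  obtain ⟨C₀, hC₀, hball⟩ := exists_pi_gaussianReal_le hd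
  have hXL := fun s ↦ (hX.gaussian.hasGaussianLaw_eval s).memLp_two
  -- The order `p` of the moments has to beat the growth rate of the nets, and to be at least `d`.
  set p : ℕ := 2 * Q ^ 2 + d with hp
  have hp0 : p ≠ 0 := by omega
  have hpQ : 2 * Q ^ 2 ≤ 2 ^ p :=
    Nat.lt_two_pow_self.le.trans (Nat.pow_le_pow_right two_pos (Nat.le_add_right _ d))
  -- `κ` is chosen so that the increments of the residuals satisfy `E ‖·‖ ^ p ≤ (c κ ρ) ^ p`.
  set κ : ℝ := 1 + (((d : ℝ≥0∞) + 1) ^ p *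
    ((d : ℝ≥0∞) ^ p * (d * absMoment p) + d * absMoment p)).toReal with hκ
  have hκ1 : 1 ≤ κ := le_add_of_nonneg_right ENNReal.toReal_nonneg
  have hκp : ((d : ℝ≥0∞) + 1) ^ p * ((d : ℝ≥0∞) ^ p * (d * absMoment p) + d * absMoment p)
      ≤ ENNReal.ofReal κ ^ p := by
    have hfin : ((d : ℝ≥0∞) + 1) ^ p *
        ((d : ℝ≥0∞) ^ p * (d * absMoment p) + d * absMoment p) ≠ ∞ := by
      have := absMoment_ne_top p
      finiteness
    rw [← ENNReal.ofReal_pow (by positivity), ← ENNReal.ofReal_toReal hfin]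
    refine ENNReal.ofReal_le_ofReal (le_trans ?_ (le_self_pow₀ hκ1 hp0))
    simp [hκ]
  set C₁ : ℝ := 2 * (A ^ 2 * Q) * (2 * (c * κ)) ^ p with hC₁
  set C₂ : ℝ := C₀ * (((√l)⁻¹) ^ d * (2 * ((2 + L + c) + 2)) ^ d) with hC₂
  have hsl : 0 < √l := Real.sqrt_pos.2 hl
  have hQ0 : (0 : ℝ) < Q := by exact_mod_cast hQ
  have hA0 : (0 : ℝ) < A := by exact_mod_cast hA
  have hκ0 : 0 < κ := by linarith
  refine ⟨C₂ * (1 + C₁), by positivity, fun t r hr f hf ↦ ?_⟩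
  obtain ⟨y, hyl, hy⟩ := exists_whitening (hXL t) hl (heig t)
  -- The residuals, the nets of the ball, and the chaining functional.
  set Z := residual μ X t y with hZ
  set S : Set I := {s : I | rho H s t ≤ r} with hS
  choose F hFcard hF using hnet I S t r hr fun s hs ↦ hs
  -- The chains have to start at `t`.
  let F' : ℕ → Finset I := fun n ↦ if n = 0 then {t} else F n
  let D : I → I → ℝ := fun u v ↦ rho H u v
  have hF'card : ∀ n, (F' n).card ≤ A * Q ^ n := by
    intro n
    rcases eq_or_ne n 0 with rfl | hn
    · simpa [F'] using hA
    · simpa [F', hn] using hFcard n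
  have hF' : ∀ s ∈ S, ∀ n, ∃ u ∈ F' n, D u s ≤ r / 4 ^ n := by
    intro s hs n
    rcases eq_or_ne n 0 with rfl | hn
    · refine ⟨t, by simp [F'], ?_⟩
      rw [pow_zero, div_one]
      exact (rho_comm _ _).trans_le hs
    · simp only [F', if_neg hn]
      exact hF n s hs
  set W : Ω → ℝ≥0∞ := fun ω ↦ chainSum D F' r p (Z · ω) with hW
  set G : Ω → Fin d → ℝ := fun ω i ↦ inner ℝ (y i) (X t ω) with hG
  have hZm : ∀ s, AEMeasurable (Z s) μ := aemeasurable_residual hX.gaussian.aemeasurable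
  have hWm : AEMeasurable W μ := aemeasurable_chainSum D F' r p hZm
  have hGm : AEMeasurable G μ :=
    aemeasurable_pi_lambda _ fun i ↦ ((hXL t).const_inner (y i)).aemeasurable
  have hcoeff : ∀ s u i, ‖regressionCoeff μ X t (y i) s - regressionCoeff μ X t (y i) u‖
      ≤ c * rho H s u := fun s u i ↦
    (norm_regressionCoeff_sub_le hXL (by simpa using hy i i) s u).trans (hmetric s u)
  have hWint : ∫⁻ ω, W ω ∂μ ≤ ENNReal.ofReal (C₁ * r ^ p) := by
    refine lintegral_chainSum_le hr hpQ hF'card hZm (by positivity) fun u v ↦ ?_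
    refine (lintegral_residual_sub_pow_le hX.gaussian hX.centered hy hp0 (hmetric u v)).trans ?_
    have h : c * κ * D u v = κ * (c * rho H u v) := by ring
    rw [h, ENNReal.ofReal_mul hκ0.le, mul_pow]
    exact mul_le_mul_left hκp _
  -- `W` is a measurable function of the coordinates of the residual process.
  have hindep : IndepFun W G μ := by
    have h := indepFun_residual (t := t) hX.gaussian hX.centered hy
    refine h.comp (φ := fun z : I × Fin d → ℝ ↦
      chainSum D F' r p fun s ↦ WithLp.toLp 2 fun j ↦ z (s, j)) (ψ := id) ?_ measurable_id
    refine (measurable_chainSum D F' r p).comp (measurable_pi_lambda _ fun s ↦ ?_)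
    exact (WithLp.measurable_toLp 2 (Fin d → ℝ)).comp
      (measurable_pi_lambda _ fun j ↦ measurable_pi_apply (s, j))
  -- On the event, the whitened coordinates `G` fall into a small random neighbourhood of `g`.
  set g : Fin d → ℝ := fun i ↦ inner ℝ (y i) (f t) with hg
  let V : Set (ℝ≥0∞ × (Fin d → ℝ)) := {q | ∀ i, |q.2 i - g i|
    ≤ (√l)⁻¹ * ((2 + L) * r + 2 * q.1.toReal ^ (p : ℝ)⁻¹) + (√l)⁻¹ * (c * r) * ∑ j, |q.2 j|}
  have hV : MeasurableSet V := by
    have hVi : V = ⋂ i, {q : ℝ≥0∞ × (Fin d → ℝ) | |q.2 i - g i| ≤ (√l)⁻¹ * ((2 + L) * r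
        + 2 * q.1.toReal ^ (p : ℝ)⁻¹) + (√l)⁻¹ * (c * r) * ∑ j, |q.2 j|} := by
      ext q
      simp [V]
    rw [hVi]
    exact MeasurableSet.iInter fun i ↦ measurableSet_le (by fun_prop) (by fun_prop)
  have hincl : ∀ᵐ ω ∂μ, (⨅ s : {s : I // (s : Fin N → ℝ) ∈ closedBallRho H t r},
      ‖X s.1 ω - f s.1‖) ≤ r → (W ω, G ω) ∈ V := by
    have hWfin : ∀ᵐ ω ∂μ, W ω < ∞ :=
      ae_lt_top' hWm (hWint.trans_lt ENNReal.ofReal_lt_top).ne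
    filter_upwards [hmod, hWfin] with ω hω hWω hinf
    have : Nonempty {s : I // (s : Fin N → ℝ) ∈ closedBallRho H t r} :=
      ⟨t, by simpa [closedBallRho, rho_self fun j ↦ (hH j).1] using hr.le⟩
    -- The infimum need not be attained, whence the factor `2`.
    obtain ⟨⟨s, hs⟩, hsr⟩ := exists_lt_of_ciInf_lt (hinf.trans_lt (by linarith : r < 2 * r))
    have hs : rho H s t ≤ r := hs
    set σ : ℝ := ∑ j, |G ω j| with hσ
    have hσ0 : 0 ≤ σ := Finset.sum_nonneg fun _ _ ↦ abs_nonneg _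
    have hcont : ∀ s ∈ S, ∀ ε > 0, ∃ δ > 0, ∀ u, D u s < δ → ‖Z u ω - Z s ω‖ < ε :=
      fun s _ ε hε ↦ residual_continuous hc (fun u s i ↦ hcoeff u s i) hω s hε
    have hZs : ‖Z s ω - Z t ω‖ ≤ 2 * (W ω).toReal ^ (p : ℝ)⁻¹ :=
      norm_sub_le_chainSum (D := D) (z := fun s ↦ Z s ω) (fun u v ↦ rho_comm _ _)
        (fun u v w ↦ rho_triangle hH _ _ _) hr (by simp [F']) hp0 hF' hcont hWω.ne hs
    have hX1 : ‖X s ω - X t ω‖ ≤ ‖Z s ω - Z t ω‖ + c * rho H s t * σ :=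
      norm_sub_le_residual_add (hcoeff s t) ω
    have hX2 : c * rho H s t * σ ≤ c * r * σ := by gcongr
    have hf1 : ‖f s - f t‖ ≤ L * r := (hf s t).trans (mul_le_mul_of_nonneg_left hs hL)
    have hmain : ‖X t ω - f t‖ ≤ (2 + L) * r + 2 * (W ω).toReal ^ (p : ℝ)⁻¹ + c * r * σ := by
      have h1 : X t ω - f t = (X s ω - f s) + (f s - f t) - (X s ω - X t ω) := by abel
      have h2 := norm_sub_le ((X s ω - f s) + (f s - f t)) (X s ω - X t ω)
      have h3 := norm_add_le (X s ω - f s) (f s - f t)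
      have h4 : ‖X s ω - f s‖ < 2 * r := hsr
      rw [h1]
      linarith
    intro i
    calc |G ω i - g i| = |inner ℝ (y i) (X t ω - f t)| := by rw [inner_sub_right]
      _ ≤ ‖y i‖ * ‖X t ω - f t‖ := abs_real_inner_le_norm _ _
      _ ≤ (√l)⁻¹ * ((2 + L) * r + 2 * (W ω).toReal ^ (p : ℝ)⁻¹ + c * r * σ) := by
          gcongr
          exact hyl i
      _ = _ := by simp only [← hσ]; ring
  have hsection : ∀ w : ℝ≥0∞, μ.map G (Prod.mk w ⁻¹' V)
      ≤ ENNReal.ofReal (C₂ * r ^ d) * (1 + w * ENNReal.ofReal (1 / r ^ p)) := by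
    intro w
    rw [hG, map_whitening_eq (hX.gaussian.hasGaussianLaw_eval t) (hX.centered t) hy]
    refine (hball g ((√l)⁻¹ * ((2 + L) * r + 2 * w.toReal ^ (p : ℝ)⁻¹)) ((√l)⁻¹ * (c * r))
      (by positivity) (by positivity)).trans ?_
    have h1 : ENNReal.ofReal (1 + w.toReal * (1 / r ^ p))
        ≤ 1 + w * ENNReal.ofReal (1 / r ^ p) := by
      rw [ENNReal.ofReal_add zero_le_one (by positivity), ENNReal.ofReal_one,
        ENNReal.ofReal_mul ENNReal.toReal_nonneg]
      gcongr
      exact ENNReal.ofReal_toReal_le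
    refine le_trans ?_ (mul_le_mul_right h1 _)
    rw [← ENNReal.ofReal_mul (by positivity)]
    refine ENNReal.ofReal_le_ofReal ?_
    have h2 := add_rpow_pow_le (a := 2 + L + c) (w := w.toReal) (by positivity) hr
      ENNReal.toReal_nonneg (Nat.le_add_left d (2 * Q ^ 2)) hp0
    rw [← hp] at h2
    calc C₀ * ((√l)⁻¹ * ((2 + L) * r + 2 * w.toReal ^ (p : ℝ)⁻¹) + (√l)⁻¹ * (c * r)) ^ d
        = C₀ * ((√l)⁻¹ ^ d * ((2 + L + c) * r + 2 * w.toReal ^ (p : ℝ)⁻¹) ^ d) := by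
          rw [← mul_pow]
          congr 2
          ring
      _ ≤ C₀ * ((√l)⁻¹ ^ d * ((2 * (2 + L + c + 2)) ^ d * r ^ d * (1 + w.toReal / r ^ p))) := by
          gcongr
      _ = _ := by rw [hC₂]; ring
  calc μ {ω | (⨅ s : {s : I // (s : Fin N → ℝ) ∈ closedBallRho H t r},
        ‖X s.1 ω - f s.1‖) ≤ r}
      ≤ μ {ω | (W ω, G ω) ∈ V} := measure_mono_ae hincl
    _ ≤ ∫⁻ ω, ENNReal.ofReal (C₂ * r ^ d) * (1 + W ω * ENNReal.ofReal (1 / r ^ p)) ∂μ :=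
        measure_le_lintegral_of_indepFun hindep hWm hGm hV hsection
    _ = ENNReal.ofReal (C₂ * r ^ d) * (1 + (∫⁻ ω, W ω ∂μ) * ENNReal.ofReal (1 / r ^ p)) := by
        rw [lintegral_const_mul' _ _ ENNReal.ofReal_ne_top, lintegral_add_left measurable_const,
          lintegral_mul_const' _ _ ENNReal.ofReal_ne_top, lintegral_one, measure_univ]
    _ ≤ ENNReal.ofReal (C₂ * r ^ d) *
          (1 + ENNReal.ofReal (C₁ * r ^ p) * ENNReal.ofReal (1 / r ^ p)) := by gcongr
    _ = ENNReal.ofReal (C₂ * (1 + C₁) * r ^ d) := by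
        rw [← ENNReal.ofReal_mul (by positivity), ← ENNReal.ofReal_one,
          ← ENNReal.ofReal_add zero_le_one (by positivity), ← ENNReal.ofReal_mul (by positivity)]
        congr 1
        field_simp
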